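/- Let $\varphi\in L^2(\mathbb R)$ (complex-valued), and let $$V_2(\varphi)=\Big\{\sum_{k\in\mathbb Z}c(k)\,\varphi(\cdot-k)\ :\ c=(c(k))_{k\in\mathbb Z}\in\ell^2(\mathbb Z)\Big\},$$ with the series converging unconditionally in $L^2(\mathbb R)$. Suppose that the integer translates of $\varphi$ form a Riesz basis of $V_2(\varphi)$, i.e. there are constants $A,B>0$ such that for every $c\in\ell^2(\mathbb Z)$ the series converges in $L^2(\mathbb R)$ and $$A\|c\|_{\ell^2}\le\Big\|\sum_{k\in\mathbb Z}c(k)\,\varphi(\cdot-k)\Big\|_{L^2}\le B\|c\|_{\ell^2}.$$ If $V_2(\varphi)$ is translation-invariant, i.e. $f(\cdot-t)\in V_2(\varphi)$ for every $f\in V_2(\varphi)$ and every $t\in\mathbb R$, then $\varphi\notin L^1(\mathbb R)$. -/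

import Mathlib

open MeasureTheory
open scoped ENNReal

/-- The space `L²(ℝ)` of square-integrable complex-valued functions for Lebesgue measure. -/
abbrev L2R : Type := Lp ℂ 2 (volume : Measure ℝ)

/-- The space `ℓ²(ℤ)` of square-summable complex sequences. -/
abbrev Ell2Z : Type := lp (fun _ : ℤ => ℂ) 2

/-- The translate `f(· - t)` of `f ∈ L²(ℝ)`. -/
noncomputable def translateL2 (t : ℝ) (f : L2R) : L2R :=
  Lp.compMeasurePreserving (fun x : ℝ => x - t) (measurePreserving_sub_right volume t) f

theorem translateL2_coeFn (t : ℝ) (f : L2R) :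
    (translateL2 t f : ℝ → ℂ) =ᵐ[volume] fun x => f (x - t) :=
  Lp.coeFn_compMeasurePreserving f (measurePreserving_sub_right volume t)

/-- The space `V₂(φ)` of all sums `∑ₖ c(k) φ(· - k)`, convergent in `L²(ℝ)`, with `c ∈ ℓ²(ℤ)`. -/
noncomputable def V2 (φ : L2R) : Submodule ℂ L2R where
  carrier := {f | ∃ c : Ell2Z, HasSum (fun k : ℤ => c k • translateL2 (k : ℝ) φ) f}
  zero_mem' := ⟨0, by simp⟩
  add_mem' := by
    rintro f g ⟨c, hc⟩ ⟨d, hd⟩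
    exact ⟨c + d, by simpa [add_smul] using hc.add hd⟩
  smul_mem' := by
    rintro a f ⟨c, hc⟩
    exact ⟨a • c, by simpa [smul_smul] using hc.const_smul a⟩

/-- The integer translates of `φ` form a Riesz basis of `V₂(φ)`: there are constants `A, B > 0`
such that for every `c ∈ ℓ²(ℤ)` the series `∑ₖ c(k) φ(· - k)` converges in `L²(ℝ)` and
`A ‖c‖ ≤ ‖∑ₖ c(k) φ(· - k)‖ ≤ B ‖c‖`. -/
def IsRieszGenerator (φ : L2R) : Prop :=
  ∃ A B : ℝ, 0 < A ∧ 0 < B ∧ ∀ c : Ell2Z, ∃ f : L2R,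
    HasSum (fun k : ℤ => c k • translateL2 (k : ℝ) φ) f ∧ A * ‖c‖ ≤ ‖f‖ ∧ ‖f‖ ≤ B * ‖c‖

/-- The invariance set `τ(V)` of all real `t` such that `f(· - t) ∈ V` for every `f ∈ V`. -/
def invarianceSet (V : Submodule ℂ L2R) : Set ℝ :=
  {t | ∀ f ∈ V, translateL2 t f ∈ V}

/-- `V` is translation-invariant, that is, invariant under all real translations. -/
def IsTranslationInvariant (V : Submodule ℂ L2R) : Prop :=
  invarianceSet V = Set.univ

/-! If `φ` is integrable, its inverse Fourier transform `G` is continuous. By Plancherel,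
approximating a translate of `φ` by integer translates means approximating a character by 1-periodic
trigonometric polynomials in `L²(|G|²)`. For the translate by `1/(2k)` the character changes sign
under `ξ ↦ ξ + k`, so `G ξ * G (ξ + k) = 0` for `k ≠ 0` (`mul_shift_eq_zero`). As integer shifts of
`G` do not overlap, the lower Riesz bound `A` acts on each one separately and gives `A ≤ |G|`
wherever `G ≠ 0` (`le_norm_of_ne_zero`). By continuity `G` vanishes everywhere or nowhere: the first
contradicts the Riesz bound, the second `G 0 * G 1 = 0`. -/

open FourierTransform in
/-- On `L¹ ∩ L²` the `L²` inverse Fourier transform is given by the Fourier integral. -/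
theorem Lp.coeFn_fourierInv_ae_eq (g : L2R) (hg : Integrable (g : ℝ → ℂ)) :
    ((𝓕⁻ g : L2R) : ℝ → ℂ) =ᵐ[volume] 𝓕⁻ (g : ℝ → ℂ) := by
  have hc : Continuous (𝓕⁻ (g : ℝ → ℂ)) :=
    VectorFourier.fourierIntegral_continuous Real.continuous_fourierChar
      (by exact (innerSL ℝ).continuous₂.neg) hg
  refine ae_eq_of_integral_contDiff_smul_eq
    ((Lp.memLp _).locallyIntegrable (by norm_num)) hc.locallyIntegrable fun u hu hus => ?_
  let v : SchwartzMap ℝ ℂ := HasCompactSupport.toSchwartzMap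
    (f := fun x => (u x : ℂ)) (hus.comp_left (g := ((↑) : ℝ → ℂ)) (by simp))
    (Complex.ofRealCLM.contDiff.comp hu)
  have hv : ∀ x, v x = (u x : ℂ) := fun x => rfl
  -- As a tempered distribution, the `L²` transform is moved onto the test function; Fubini moves it
  -- back onto the integrable `g`.
  have h := congrArg (fun T => T v) (Lp.fourierInv_toTemperedDistribution_eq g)
  simp only [TemperedDistribution.fourierInv_apply, Lp.toTemperedDistribution_apply, hv] at h
  have h2 := VectorFourier.integral_fourierIntegral_smul_eq_flip (μ := volume) (ν := volume)
    (L := -innerₗ ℝ) (f := (v : ℝ → ℂ)) (g := (g : ℝ → ℂ)) Real.continuous_fourierChar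
    (by exact (innerSL ℝ).continuous₂.neg) v.integrable hg
  have h3 : (-innerₗ ℝ : ℝ →ₗ[ℝ] ℝ →ₗ[ℝ] ℝ).flip = -innerₗ ℝ := by
    ext; simp
  rw [h3] at h2
  simp only [SchwartzMap.fourierInv_coe] at h
  have h4 : ∫ x, v x • (𝓕⁻ g : L2R) x = ∫ x, v x • 𝓕⁻ (g : ℝ → ℂ) x := h.symm.trans h2
  simpa [hv] using h4

theorem norm_sq_eq_integral_norm_sq (f : L2R) : ‖f‖ ^ 2 = ∫ x, ‖f x‖ ^ 2 := by
  have h := inner_self_eq_norm_sq_to_K (𝕜 := ℂ) f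
  rw [L2.inner_def] at h
  have h1 : ∀ x, inner ℂ (f x) (f x) = ((‖f x‖ ^ 2 : ℝ) : ℂ) := fun x => by
    rw [inner_self_eq_norm_sq_to_K]; simp
  simp_rw [h1] at h
  rw [integral_complex_ofReal] at h
  simp only [Complex.coe_algebraMap] at h
  exact_mod_cast h.symm

open FourierTransform in
theorem fourierInv_comp_sub (f : ℝ → ℂ) (t ξ : ℝ) :
    𝓕⁻ (fun x => f (x - t)) ξ = Real.fourierChar (t * ξ) * 𝓕⁻ f ξ := by
  have := congrFun (VectorFourier.fourierIntegral_comp_add_right Real.fourierChar volume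
    (-innerₗ ℝ) f (-t)) ξ
  have h : (f ∘ fun v => v + -t) = fun x => f (x - t) := by ext; simp [sub_eq_add_neg]
  rw [h] at this
  refine this.trans ?_
  simp [Circle.smul_def, mul_comm t ξ]
  rfl

open FourierTransform in
/-- Plancherel's identity for a finite combination of translates of an element of `L¹ ∩ L²`. -/
theorem norm_sq_sum_translateL2 {φ : L2R} (hφ : Integrable (φ : ℝ → ℂ)) {ι : Type*}
    (s : Finset ι) (c : ι → ℂ) (t : ι → ℝ) :
    Integrable (fun ξ => ‖∑ i ∈ s, c i * Real.fourierChar (t i * ξ)‖ ^ 2 *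
      ‖𝓕⁻ (φ : ℝ → ℂ) ξ‖ ^ 2) ∧
    ‖∑ i ∈ s, c i • translateL2 (t i) φ‖ ^ 2 =
      ∫ ξ, ‖∑ i ∈ s, c i * Real.fourierChar (t i * ξ)‖ ^ 2 * ‖𝓕⁻ (φ : ℝ → ℂ) ξ‖ ^ 2 := by
  set g : L2R := ∑ i ∈ s, c i • translateL2 (t i) φ with hg
  have hint : ∀ i, Integrable (fun x => φ (x - t i)) := fun i => hφ.comp_sub_right (t i)
  have hga : (g : ℝ → ℂ) =ᵐ[volume] fun x => ∑ i ∈ s, c i * φ (x - t i) := by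
    have h2 : ∀ᵐ x, ∀ i ∈ s, (c i • translateL2 (t i) φ : L2R) x = c i * φ (x - t i) := by
      refine (Finset.eventually_all s).2 fun i _ => ?_
      filter_upwards [Lp.coeFn_smul (c i) (translateL2 (t i) φ), translateL2_coeFn (t i) φ]
        with x h1 h2
      rw [h1, Pi.smul_apply, h2, smul_eq_mul]
    filter_upwards [Lp.coeFn_finsetSum s fun i => c i • translateL2 (t i) φ, h2] with x h1 h2
    rw [hg, h1, Finset.sum_apply]
    exact Finset.sum_congr rfl h2
  have hgi : Integrable (g : ℝ → ℂ) :=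
    (integrable_finsetSum s fun i _ => (hint i).const_mul (c i)).congr hga.symm
  have hF : ∀ ξ, 𝓕⁻ (g : ℝ → ℂ) ξ =
      (∑ i ∈ s, c i * Real.fourierChar (t i * ξ)) * 𝓕⁻ (φ : ℝ → ℂ) ξ := fun ξ => by
    rw [Real.fourierInv_congr_ae hga, Real.fourierInv_eq]
    simp_rw [Finset.smul_sum]
    rw [integral_finsetSum, Finset.sum_mul]
    · refine Finset.sum_congr rfl fun i _ => ?_
      rw [mul_assoc, ← fourierInv_comp_sub, Real.fourierInv_eq, ← integral_const_mul]
      simp only [mul_smul_comm]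
    · intro i _
      have := (VectorFourier.fourierIntegral_convergent_iff (μ := volume) (L := -innerₗ ℝ)
        Real.continuous_fourierChar (by exact (innerSL ℝ).continuous₂.neg) ξ).2
        ((hint i).const_mul (c i))
      simpa using this
  have h1 : ‖(𝓕⁻ g : L2R)‖ = ‖g‖ := (Lp.fourierTransformₗᵢ ℝ ℂ).symm.norm_map g
  have hae : (fun ξ => ‖(𝓕⁻ g : L2R) ξ‖ ^ 2) =ᵐ[volume] fun ξ =>
      ‖∑ i ∈ s, c i * Real.fourierChar (t i * ξ)‖ ^ 2 * ‖𝓕⁻ (φ : ℝ → ℂ) ξ‖ ^ 2 := by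
    filter_upwards [Lp.coeFn_fourierInv_ae_eq g hgi] with ξ h
    rw [h, hF, norm_mul, mul_pow]
  refine ⟨((Lp.memLp (𝓕⁻ g : L2R)).integrable_norm_pow two_ne_zero).congr hae, ?_⟩
  rw [← h1, norm_sq_eq_integral_norm_sq]
  exact integral_congr_ae hae

/-! ### Weighted norms of periodic functions -/

theorem continuous_integral_norm_sq_mul {X Y : Type*} [TopologicalSpace X] [MeasurableSpace X]
    [BorelSpace X] {μ : Measure X} [TopologicalSpace Y] [CompactSpace Y] {w : X → ℝ}
    (hw : Integrable w μ) {q : X → Y} (hq : Continuous q) :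
    Continuous fun h : C(Y, ℂ) => ∫ x, ‖h (q x)‖ ^ 2 * w x ∂μ := by
  refine continuous_iff_continuousAt.2 fun h => ?_
  have hmeas : ∀ g : C(Y, ℂ), AEStronglyMeasurable (fun x => ‖g (q x)‖ ^ 2 * w x) μ := fun g => by
    have h1 : Continuous fun x => ‖g (q x)‖ ^ 2 := by fun_prop
    exact h1.measurable.aestronglyMeasurable.mul hw.1
  refine tendsto_integral_filter_of_dominated_convergence (fun x => (‖h‖ + 1) ^ 2 * ‖w x‖)
    (.of_forall hmeas) ?_ (hw.norm.const_mul _) (.of_forall fun x => ?_)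
  · have h1 : ∀ᶠ g : C(Y, ℂ) in nhds h, ‖g‖ < ‖h‖ + 1 :=
      continuous_norm.continuousAt.eventually_lt continuousAt_const (by simp)
    filter_upwards [h1] with g hg
    refine .of_forall fun x => ?_
    rw [norm_mul, norm_pow, norm_norm]
    gcongr
    exact (g.norm_coe_le_norm _).trans hg.le
  · have h1 : Continuous fun g : C(Y, ℂ) => ‖g (q x)‖ ^ 2 * w x := by fun_prop
    exact h1.tendsto h

theorem fourier_coe_eq_fourierChar (k : ℤ) (ξ : ℝ) :
    fourier k (ξ : UnitAddCircle) = Real.fourierChar (k * ξ) := by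
  rw [fourier_coe_apply, Real.fourierChar_apply]
  push_cast
  congr 1
  ring

theorem integral_norm_sq_sum_fourier (s : Finset ℤ) (c : ℤ → ℂ) :
    ∫ x : UnitAddCircle, ‖∑ k ∈ s, c k * fourier k x‖ ^ 2 ∂AddCircle.haarAddCircle =
      ∑ k ∈ s, ‖c k‖ ^ 2 := by
  have ho := orthonormal_fourier (T := 1)
  set g : Lp ℂ 2 (AddCircle.haarAddCircle (T := 1)) := ∑ k ∈ s, c k • fourierLp 2 k with hg
  have h1 : inner ℂ g g = ∑ k ∈ s, ((‖c k‖ ^ 2 : ℝ) : ℂ) := by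
    rw [hg, ho.inner_sum]
    refine Finset.sum_congr rfl fun k _ => ?_
    rw [Complex.conj_mul']; norm_cast
  have hga : (g : UnitAddCircle → ℂ) =ᵐ[AddCircle.haarAddCircle]
      fun x => ∑ k ∈ s, c k * fourier k x := by
    have h2 : ∀ᵐ x ∂AddCircle.haarAddCircle (T := 1), ∀ k ∈ s,
        (c k • fourierLp (T := 1) 2 k : Lp ℂ 2 AddCircle.haarAddCircle) x
          = c k * fourier k x := by
      refine (Finset.eventually_all s).2 fun k _ => ?_
      filter_upwards [Lp.coeFn_smul (c k) (fourierLp (T := 1) 2 k), coeFn_fourierLp (T := 1) 2 k]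
        with x h1 h2
      rw [h1, Pi.smul_apply, h2, smul_eq_mul]
    filter_upwards [Lp.coeFn_finsetSum s fun k => c k • fourierLp (T := 1) 2 k, h2] with x h1 h2
    rw [hg, h1, Finset.sum_apply]
    exact Finset.sum_congr rfl h2
  rw [L2.inner_def, integral_congr_ae (g := fun x =>
    ((‖∑ k ∈ s, c k * fourier k x‖ ^ 2 : ℝ) : ℂ)), integral_complex_ofReal] at h1
  · exact_mod_cast h1
  · filter_upwards [hga] with x hx
    rw [hx, inner_self_eq_norm_sq_to_K]
    simp

/-- A lower bound for trigonometric polynomials in a weighted `L²` norm extends to all continuous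
periodic functions. -/
theorem le_integral_of_forall_trigPoly {A : ℝ} {w : ℝ → ℝ} (hw : Integrable w)
    (hA : ∀ (s : Finset ℤ) (c : ℤ → ℂ), A ^ 2 * ∑ k ∈ s, ‖c k‖ ^ 2 ≤
      ∫ ξ, ‖∑ k ∈ s, c k * Real.fourierChar (k * ξ)‖ ^ 2 * w ξ) (h : C(UnitAddCircle, ℂ)) :
    A ^ 2 * ∫ x, ‖h x‖ ^ 2 ∂AddCircle.haarAddCircle ≤
      ∫ ξ : ℝ, ‖h (ξ : UnitAddCircle)‖ ^ 2 * w ξ := by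
  have h1 : IsClosed {h : C(UnitAddCircle, ℂ) |
      A ^ 2 * ∫ x, ‖h x‖ ^ 2 ∂AddCircle.haarAddCircle ≤
      ∫ ξ : ℝ, ‖h (ξ : UnitAddCircle)‖ ^ 2 * w ξ} := by
    refine isClosed_le (continuous_const.mul ?_)
      (continuous_integral_norm_sq_mul hw (AddCircle.continuous_mk' 1))
    simpa using continuous_integral_norm_sq_mul (μ := AddCircle.haarAddCircle (T := 1))
      (integrable_const (1 : ℝ)) (continuous_id (X := UnitAddCircle))
  -- Trigonometric polynomials are uniformly dense, so the closed condition `h1` need only be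
  -- checked on them.
  have h2 : h ∈ (Submodule.span ℂ (Set.range (fourier (T := 1)))).topologicalClosure := by
    rw [span_fourier_closure_eq_top]; trivial
  refine closure_minimal ?_ h1 h2
  intro p hp
  obtain ⟨c, rfl⟩ := (Finsupp.mem_span_range_iff_exists_finsupp).1 hp
  have hpx : ∀ x : UnitAddCircle, (c.sum fun i a => a • fourier (T := 1) i) x
      = ∑ k ∈ c.support, c k * fourier k x := fun x => by
    simp [Finsupp.sum]
  simp only [Set.mem_ofPred_eq, hpx, integral_norm_sq_sum_fourier, fourier_coe_eq_fourierChar]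
  exact hA _ _

/-- A `k`-periodic `p` cannot be close to both `e` and `-e`, so its error at `ξ` and `ξ + k`
together controls the smaller of the two weights. That minimum has integral zero and is continuous,
hence vanishes. -/
theorem mul_shift_eq_zero {G : ℝ → ℂ} (hG : Continuous G)
    (hGi : Integrable fun ξ => ‖G ξ‖ ^ 2) {k : ℤ} {e : ℝ → ℂ} (he : ∀ ξ, ‖e ξ‖ = 1)
    (hek : ∀ ξ, e (ξ + k) = -e ξ)
    (happ : ∀ ε > 0, ∃ p : ℝ → ℂ, (∀ ξ, p (ξ + k) = p ξ) ∧
      Integrable (fun ξ => ‖e ξ - p ξ‖ ^ 2 * ‖G ξ‖ ^ 2) ∧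
      ∫ ξ, ‖e ξ - p ξ‖ ^ 2 * ‖G ξ‖ ^ 2 ≤ ε) (ξ : ℝ) : G ξ * G (ξ + k) = 0 := by
  set m : ℝ → ℝ := fun ξ => min (‖G ξ‖ ^ 2) (‖G (ξ + k)‖ ^ 2) with hm
  have hmc : Continuous m := by fun_prop
  have hm0 : ∀ ξ, 0 ≤ m ξ := fun ξ => by positivity
  have hmi : Integrable m := hGi.mono' hmc.aestronglyMeasurable
    (.of_forall fun ξ => by rw [Real.norm_of_nonneg (hm0 ξ)]; exact min_le_left _ _)
  have hle : ∫ ξ, m ξ ≤ 0 := by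
    refine le_of_forall_pos_le_add fun ε hε => ?_
    obtain ⟨p, hp, hi, hpe⟩ := happ ε hε
    set f : ℝ → ℝ := fun ξ => ‖e ξ - p ξ‖ ^ 2 * ‖G ξ‖ ^ 2 with hf
    have h1 : ∀ ξ, m ξ ≤ (f ξ + f (ξ + k)) / 2 := fun ξ => by
      simp only [hf, hp, hek]
      have h2 : 2 ≤ ‖e ξ - p ξ‖ + ‖-e ξ - p ξ‖ := by
        have := norm_sub_le (e ξ - p ξ) (-e ξ - p ξ)
        have h3 : e ξ - p ξ - (-e ξ - p ξ) = 2 * e ξ := by ring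
        rw [h3, norm_mul, he] at this
        simpa using this
      have h4 : 2 ≤ ‖e ξ - p ξ‖ ^ 2 + ‖-e ξ - p ξ‖ ^ 2 := by
        nlinarith [sq_nonneg (‖e ξ - p ξ‖ - ‖-e ξ - p ξ‖)]
      have h5 : m ξ ≤ ‖G ξ‖ ^ 2 := min_le_left _ _
      have h6 : m ξ ≤ ‖G (ξ + k)‖ ^ 2 := min_le_right _ _
      nlinarith [mul_le_mul_of_nonneg_left h5 (sq_nonneg ‖e ξ - p ξ‖),
        mul_le_mul_of_nonneg_left h6 (sq_nonneg ‖-e ξ - p ξ‖),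
        mul_le_mul_of_nonneg_right h4 (hm0 ξ)]
    have h2 : ∫ ξ, m ξ ≤ ∫ ξ, (f ξ + f (ξ + k)) / 2 :=
      integral_mono hmi ((hi.add (hi.comp_add_right (k : ℝ))).div_const 2) h1
    rw [integral_div, integral_add hi (hi.comp_add_right (k : ℝ)),
      integral_add_right_eq_self f] at h2
    linarith
  have h0 : m =ᵐ[volume] 0 := (integral_eq_zero_iff_of_nonneg hm0 hmi).1
    (le_antisymm hle (integral_nonneg hm0))
  have h1 : m ξ = 0 := congrFun ((hmc.ae_eq_iff_eq volume continuous_const).1 h0) ξ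
  rcases min_choice (‖G ξ‖ ^ 2) (‖G (ξ + k)‖ ^ 2) with h | h <;>
    simp only [hm, h] at h1 <;> simp at h1 <;> simp [h1]

/-- If the integer shifts of a function have disjoint supports and its weighted `L²` norm dominates
that of periodic functions, then its nonzero values are bounded away from zero. -/
theorem le_norm_of_ne_zero {G : ℝ → ℂ} (hG : Continuous G) {A : ℝ}
    (hdisj : ∀ (k : ℤ), k ≠ 0 → ∀ ξ, G ξ * G (ξ + k) = 0)
    (hA : ∀ h : C(UnitAddCircle, ℂ), A ^ 2 * ∫ x, ‖h x‖ ^ 2 ∂AddCircle.haarAddCircle ≤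
      ∫ ξ : ℝ, ‖h (ξ : UnitAddCircle)‖ ^ 2 * ‖G ξ‖ ^ 2) {ξ₀ : ℝ} (h0 : G ξ₀ ≠ 0) :
    A ≤ ‖G ξ₀‖ := by
  by_contra! hlt
  obtain ⟨M, hM1, hM2⟩ := exists_between hlt
  have hM0 : 0 ≤ M := (norm_nonneg _).trans hM1.le
  have hev : ∀ᶠ ξ in nhds ξ₀, G ξ ≠ 0 ∧ ‖G ξ‖ < M :=
    (hG.continuousAt.eventually_ne h0).and
      (hG.norm.continuousAt.eventually_lt continuousAt_const hM1)
  obtain ⟨δ', hδ', hball⟩ := Metric.eventually_nhds_iff.1 hev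
  -- Radius at most `1 / 2` keeps the tent around `ξ₀` within one period.
  set δ := min δ' (1 / 2) with hδ
  have hδ0 : 0 < δ := by positivity
  let h : C(UnitAddCircle, ℂ) :=
    ⟨fun x => ((max 0 (δ - ‖x - (ξ₀ : UnitAddCircle)‖) : ℝ) : ℂ), by fun_prop⟩
  have hh : ∀ x, h x = ((max 0 (δ - ‖x - (ξ₀ : UnitAddCircle)‖) : ℝ) : ℂ) := fun _ => rfl
  have hhc : Continuous fun x => ‖h x‖ ^ 2 := by fun_prop
  have hpos : 0 < ∫ x, ‖h x‖ ^ 2 ∂AddCircle.haarAddCircle := by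
    refine hhc.integral_pos_of_hasCompactSupport_nonneg_nonzero
      (HasCompactSupport.of_compactSpace _) (fun x => by positivity) (x := (ξ₀ : UnitAddCircle)) ?_
    rw [hh]
    simp [hδ0.le, hδ0.ne']
  have hint : ∫ x, ‖h x‖ ^ 2 ∂AddCircle.haarAddCircle =
      ∫ ξ in Set.Ioc (ξ₀ - 1 / 2) (ξ₀ - 1 / 2 + 1), ‖h (ξ : UnitAddCircle)‖ ^ 2 := by
    rw [AddCircle.integral_preimage 1 (ξ₀ - 1 / 2) (fun x : UnitAddCircle => ‖h x‖ ^ 2),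
      AddCircle.volume_eq_smul_haarAddCircle]
    simp
  have hpt : ∀ ξ : ℝ, ‖h (ξ : UnitAddCircle)‖ ^ 2 * ‖G ξ‖ ^ 2 ≤
      (Set.Ioc (ξ₀ - 1 / 2) (ξ₀ - 1 / 2 + 1)).indicator
        (fun ξ : ℝ => M ^ 2 * ‖h (ξ : UnitAddCircle)‖ ^ 2) ξ := fun ξ => by
    have hr : 0 ≤ (Set.Ioc (ξ₀ - 1 / 2) (ξ₀ - 1 / 2 + 1)).indicator
        (fun ξ : ℝ => M ^ 2 * ‖h (ξ : UnitAddCircle)‖ ^ 2) ξ :=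
      Set.indicator_nonneg (fun _ _ => by positivity) _
    by_cases hz : h (ξ : UnitAddCircle) = 0
    · simpa [hz] using hr
    have hd : ‖(ξ : UnitAddCircle) - (ξ₀ : UnitAddCircle)‖ < δ := by
      by_contra! hge
      exact hz (by rw [hh, max_eq_left (by linarith)]; simp)
    rw [← AddCircle.coe_sub, UnitAddCircle.norm_eq] at hd
    set k := round (ξ - ξ₀) with hk
    have hξ : dist (ξ - k) ξ₀ < δ := by
      rw [Real.dist_eq, sub_right_comm]; exact hd
    have hg := hball (hξ.trans_le (min_le_left _ _))
    by_cases hk0 : k = 0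
    · have h2 : |ξ - ξ₀| < 1 / 2 := by
        simpa [hk0] using hd.trans_le (min_le_right _ _)
      obtain ⟨h3, h4⟩ := abs_lt.1 h2
      have hI : ξ ∈ Set.Ioc (ξ₀ - 1 / 2) (ξ₀ - 1 / 2 + 1) := ⟨by linarith, by linarith⟩
      rw [Set.indicator_of_mem hI, mul_comm]
      have h5 : ‖G ξ‖ < M := by simpa [hk0] using hg.2
      gcongr
    -- On the other copies of the tent `G` vanishes, being nonzero at `ξ - k`.
    · have h2 := hdisj k hk0 (ξ - k)
      rw [sub_add_cancel] at h2
      have h3 := (mul_eq_zero.1 h2).resolve_left hg.1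
      simpa [h3] using hr
  have h1 := hA h
  have h2 : ∫ ξ : ℝ, ‖h (ξ : UnitAddCircle)‖ ^ 2 * ‖G ξ‖ ^ 2 ≤
      M ^ 2 * ∫ x, ‖h x‖ ^ 2 ∂AddCircle.haarAddCircle := by
    rw [hint, ← integral_const_mul, ← integral_indicator measurableSet_Ioc]
    refine integral_mono_of_nonneg (.of_forall fun ξ => by positivity) ?_ (.of_forall hpt)
    rw [integrable_indicator_iff measurableSet_Ioc]
    have hc : Continuous fun ξ : ℝ => M ^ 2 * ‖h (ξ : UnitAddCircle)‖ ^ 2 :=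
      continuous_const.mul (hhc.comp (AddCircle.continuous_mk' 1))
    exact hc.integrableOn_Ioc
  have h3 : M ^ 2 < A ^ 2 := by gcongr
  nlinarith

/-! ### Riesz bound and conclusion -/

theorem IsRieszGenerator.exists_le_norm_sum {φ : L2R} (hφ : IsRieszGenerator φ) :
    ∃ A : ℝ, 0 < A ∧ ∀ (s : Finset ℤ) (c : ℤ → ℂ),
      A ^ 2 * ∑ k ∈ s, ‖c k‖ ^ 2 ≤ ‖∑ k ∈ s, c k • translateL2 (k : ℝ) φ‖ ^ 2 := by
  obtain ⟨A, B, hA, -, h⟩ := hφ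
  refine ⟨A, hA, fun s c => ?_⟩
  obtain ⟨f, hf, hAf, -⟩ := h (∑ k ∈ s, lp.single 2 k (c k))
  have hc : ∀ k, (∑ i ∈ s, lp.single 2 i (c i) : Ell2Z) k = if k ∈ s then c k else 0 := fun k => by
    rw [lp.coeFn_sum, Finset.sum_apply]
    simp [lp.single_apply, Pi.single_apply]
  have hfs : f = ∑ k ∈ s, c k • translateL2 (k : ℝ) φ := by
    have hf' : HasSum (fun k : ℤ => (if k ∈ s then c k else 0) • translateL2 (k : ℝ) φ) f := by
      simpa only [hc] using hf
    have h1 : HasSum (fun k : ℤ => (if k ∈ s then c k else 0) • translateL2 (k : ℝ) φ)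
        (∑ k ∈ s, (if k ∈ s then c k else 0) • translateL2 (k : ℝ) φ) :=
      hasSum_sum_of_ne_finset_zero fun k hk => by rw [if_neg hk, zero_smul]
    rw [hf'.unique h1]
    exact Finset.sum_congr rfl fun k hk => by rw [if_pos hk]
  have hn : ‖(∑ k ∈ s, lp.single 2 k (c k) : Ell2Z)‖ ^ 2 = ∑ k ∈ s, ‖c k‖ ^ 2 := by
    have := lp.norm_sum_single (E := fun _ : ℤ => ℂ) (p := 2) (by norm_num) c s
    simpa using this
  rw [← hn, ← hfs, ← mul_pow]
  gcongr

open FourierTransform in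
theorem mainTheorem1 (φ : L2R) (hφ : IsRieszGenerator φ)
    (hV : IsTranslationInvariant (V2 φ)) :
    ¬ MemLp (φ : ℝ → ℂ) 1 volume := by
  intro hL1
  have hint : Integrable (φ : ℝ → ℂ) := memLp_one_iff_integrable.1 hL1
  set G : ℝ → ℂ := 𝓕⁻ (φ : ℝ → ℂ) with hGdef
  have hG : Continuous G :=
    VectorFourier.fourierIntegral_continuous Real.continuous_fourierChar
      (by exact (innerSL ℝ).continuous₂.neg) hint
  have hGi : Integrable fun ξ => ‖G ξ‖ ^ 2 := by
    simpa using (norm_sq_sum_translateL2 hint {()} (fun _ => 1) (fun _ => 0)).1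
  obtain ⟨A, hA, hlow⟩ := hφ.exists_le_norm_sum
  have htrans : translateL2 0 φ = φ := by
    refine Lp.ext ((translateL2_coeFn _ φ).trans ?_)
    simp
  have hmem : φ ∈ V2 φ := by
    refine ⟨lp.single 2 0 1, ?_⟩
    have h1 := hasSum_single (L := .unconditional ℤ)
      (f := fun k : ℤ => (lp.single 2 0 1 : Ell2Z) k • translateL2 (k : ℝ) φ) 0
      fun k hk => by simp [lp.single_apply, hk]
    simpa [htrans] using h1
  have hdisj : ∀ k : ℤ, k ≠ 0 → ∀ ξ, G ξ * G (ξ + k) = 0 := fun k hk => by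
    have hk' : (k : ℝ) ≠ 0 := by exact_mod_cast hk
    set t : ℝ := 1 / (2 * k) with ht
    have htV : t ∈ invarianceSet (V2 φ) := hV ▸ Set.mem_univ t
    obtain ⟨c, hc⟩ := htV φ hmem
    refine mul_shift_eq_zero hG hGi (e := fun ξ => Real.fourierChar (t * ξ))
      (fun ξ => Circle.norm_coe _)
      (fun ξ => ?_) fun ε hε => ?_
    · have : t * (ξ + k) = t * ξ + 1 / 2 := by rw [ht]; field_simp
      simp only [this, AddChar.map_add_eq_mul, Circle.coe_mul]
      have h2 : (Real.fourierChar (1 / 2) : ℂ) = -1 := by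
        rw [Real.fourierChar_apply, ← Complex.exp_pi_mul_I]
        congr 1; push_cast; ring
      rw [h2, mul_neg_one]
    · have h1 : Filter.Tendsto (fun s : Finset ℤ => ‖translateL2 t φ -
          ∑ k ∈ s, c k • translateL2 (k : ℝ) φ‖ ^ 2) Filter.atTop (nhds 0) := by
        have := ((tendsto_const_nhds (x := translateL2 t φ)).sub
          (show Filter.Tendsto _ Filter.atTop _ from hc)).norm.pow 2
        simpa using this
      obtain ⟨s, hs⟩ := (h1.eventually_le_const hε).exists
      refine ⟨fun ξ => ∑ j ∈ s, c j * Real.fourierChar (j * ξ), fun ξ => ?_, ?_⟩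
      · refine Finset.sum_congr rfl fun j _ => ?_
        rw [← fourier_coe_eq_fourierChar, ← fourier_coe_eq_fourierChar]
        congr 2
        rw [AddCircle.coe_add]
        simp
      -- The index `none` carries the translate by `t`, so the approximation error is a single
      -- combination of translates.
      · have h2 := norm_sq_sum_translateL2 hint s.insertNone
          (fun i => i.elim 1 fun j => -c j) (fun i => i.elim t fun j : ℤ => (j : ℝ))
        simp only [Finset.sum_insertNone, Option.elim_none, Option.elim_some, one_smul, one_mul,
          neg_smul, neg_mul, Finset.sum_neg_distrib, ← sub_eq_add_neg] at h2
        exact ⟨h2.1, h2.2 ▸ hs⟩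
  have hcirc := le_integral_of_forall_trigPoly hGi fun s c =>
    (norm_sq_sum_translateL2 hint s c fun k : ℤ => (k : ℝ)).2 ▸ hlow s c
  have hge : ∀ ξ, G ξ ≠ 0 → A ≤ ‖G ξ‖ := fun ξ h => le_norm_of_ne_zero hG hdisj hcirc h
  by_cases hz : ∀ ξ, G ξ = 0
  · have h1 := hcirc 1
    simp [hz, hA.ne'] at h1
  · push Not at hz
    obtain ⟨ξ₁, h1⟩ := hz
    have hz0 : G 0 = 0 ∨ G 1 = 0 := by
      simpa using hdisj 1 one_ne_zero 0
    obtain ⟨ξ₂, h2⟩ : ∃ ξ, G ξ = 0 := hz0.elim (fun h => ⟨0, h⟩) fun h => ⟨1, h⟩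
    -- The value `A / 2` lies in the gap that `hge` forbids.
    obtain ⟨ξ, h3⟩ := mem_range_of_exists_le_of_exists_ge hG.norm (c := A / 2)
      ⟨ξ₂, by simpa [h2] using (half_pos hA).le⟩ ⟨ξ₁, by linarith [hge ξ₁ h1]⟩
    replace h3 : ‖G ξ‖ = A / 2 := h3
    have h4 : G ξ ≠ 0 := norm_pos_iff.1 (by rw [h3]; positivity)
    linarith [hge ξ h4]
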